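/- Let $N\ge 1$ and let $\Omega\subset\mathbb R^N$ be a bounded open set; all function spaces are real, $L^2=L^2(\Omega)$, $H^1=W^{1,2}(\Omega)$, $H^2=W^{2,2}(\Omega)$, and $H^1_0$ is the closure of $C_c^\infty=C_c^\infty(\Omega)$ in $H^1$. Consider the following operators in $L^2$. (a) $T_0=-\Delta$ with domain $D(T_0)=C_c^\infty$ (classical Laplacian). (b) The strong Dirichlet Laplacian $-\Delta$ with domain $H^1_0\cap H^2$, $-\Delta u=-\sum_{i=1}^N\partial_i\partial_i u$ (weak derivatives). (c) The weak Dirichlet Laplacian $(-\Delta)_\omega$: $u\in D((-\Delta)_\omega)$ and $(-\Delta)_\omega u=g$ if and only if $u\in H^1_0$, $g\in L^2$ and $\int_\Omega\nabla u\cdot\nabla v\,dx=\int_\Omega g\,v\,dx$ for every $v\in H^1_0$. (d) The Friedrichs extension $S$ of $T_0$. Put $a_0(u,v)=\langle T_0u,v\rangle_{L^2}$ on $C_c^\infty$. Let $V$ be the set of all $u\in L^2$ for which there is a sequence $(u_n)\subset C_c^\infty$ that is Cauchy for the norm $\sqrt{a_0(\cdot,\cdot)}$ and converges to $u$ in $L^2$,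 and let $\langle u,v\rangle_V=\lim a_0(u_n,v_n)$ for such sequences $(u_n)$, $(v_n)$ approximating $u$, $v$. Then $D(S)$ is the set of all $u\in V$ for which $\langle u,\cdot\rangle_V$ is continuous on $V$ for the topology induced from $L^2$, and $Su\in L^2$ is the element with $\langle u,v\rangle_V=\langle Su,v\rangle_{L^2}$ for all $v\in V$. Then: 1. $T_0$ is densely defined and symmetric, and there is $c>0$ (which may depend on $\Omega$) such that $\langle T_0u,u\rangle\ge c\|u\|^2$ for all $u\in C_c^\infty$. 2. $V=H^1_0$, the limit defining $\langle u,v\rangle_V$ exists and does not depend on the approximating sequences, and $\langle u,v\rangle_V=\int_\Omega\nabla u\cdot\nabla v\,dx$ for all $u,v\in H^1_0$. 3. $D(S)=D((-\Delta)_\omega)$ and $S=(-\Delta)_\omega$. 4. $(-\Delta)_\omega$ is densely defined, self-adjoint, i.e. $[(-\Delta)_\omega]^*=(-\Delta)_\omega$, and a bijection from $D((-\Delta)_\omega)$ onto $L^2$. 5. $T_0\subset(-\Delta)\subset(-\Delta)_\omega$ (inclusion of graphs). -/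

import Mathlib

open MeasureTheory Filter Topology TopologicalSpace
open scoped ContDiff Distributions InnerProductSpace LinearPMap Laplacian

noncomputable section

/-! ### The Friedrichs procedure for a densely defined operator on a real Hilbert space -/

namespace Friedrichs

variable {H : Type*} [NormedAddCommGroup H] [InnerProductSpace ℝ H]

/-- The quadratic form `a₀(u, v) = ⟪T u, v⟫` on the domain of `T`. -/
def form (T : H →ₗ.[ℝ] H) (u v : T.domain) : ℝ := ⟪T u, (v : H)⟫_ℝ

/-- The energy norm `p₀(u) = √a₀(u, u)` on the domain of `T`. -/
def energyNorm (T : H →ₗ.[ℝ] H) (u : T.domain) : ℝ := √(form T u u)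

/-- `w` is a sequence in the domain of `T` that is Cauchy for the energy norm and converges to `u`
in `H`. -/
def IsApprox (T : H →ₗ.[ℝ] H) (w : ℕ → T.domain) (u : H) : Prop :=
  (∀ ε > 0, ∃ n₀, ∀ m ≥ n₀, ∀ n ≥ n₀, energyNorm T (w m - w n) < ε) ∧
    Tendsto (fun n => (w n : H)) atTop (𝓝 u)

/-- The form domain `V`. -/
def formDomain (T : H →ₗ.[ℝ] H) : Set H := {u | ∃ w : ℕ → T.domain, IsApprox T w u}

open Classical in
/-- The scalar product `⟪u, v⟫_V = lim a₀(uₙ, vₙ)` on `V`, where `uₙ`, `vₙ` are approximating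
sequences of `u`, `v` (and `0` outside of `V`). -/
def formInner (T : H →ₗ.[ℝ] H) (u v : H) : ℝ :=
  if h : u ∈ formDomain T ∧ v ∈ formDomain T then
    limUnder atTop fun n => form T (h.1.choose n) (h.2.choose n)
  else 0

/-- The domain `D(S)` of the Friedrichs extension: all `u ∈ V` for which the functional
`⟪u, ·⟫_V` is continuous on `V` for the topology induced from `H`. -/
def extensionDomain (T : H →ₗ.[ℝ] H) : Set H :=
  {u | u ∈ formDomain T ∧ Continuous fun v : formDomain T => formInner T u v}

/-- The graph of the Friedrichs extension `S`: for `u ∈ D(S)`, the element `f = S u` of `H` is the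
one that represents the functional `⟪u, ·⟫_V`. -/
def extensionGraph (T : H →ₗ.[ℝ] H) : Set (H × H) :=
  {p | p.1 ∈ extensionDomain T ∧ ∀ v ∈ formDomain T, formInner T p.1 v = ⟪p.2, v⟫_ℝ}

end Friedrichs

/-! ### Sobolev spaces and Laplacians on an open set -/

namespace Dirichlet

variable {N : ℕ}

/-- The real space `L²(Ω)`. -/
abbrev L2 (Ω : Opens (EuclideanSpace ℝ (Fin N))) : Type :=
  Lp ℝ 2 (volume.restrict (Ω : Set (EuclideanSpace ℝ (Fin N))))

variable {Ω : Opens (EuclideanSpace ℝ (Fin N))}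

theorem memLp_of_test (φ : 𝓓(Ω, ℝ)) :
    MemLp φ 2 (volume.restrict (Ω : Set (EuclideanSpace ℝ (Fin N)))) :=
  φ.continuous.memLp_of_hasCompactSupport φ.hasCompactSupport

theorem contDiff_two_of_test (φ : 𝓓(Ω, ℝ)) : ContDiff ℝ 2 φ :=
  contDiff_infty.1 φ.contDiff 2

theorem laplacian_test_eq (φ : 𝓓(Ω, ℝ)) :
    (Δ (φ : EuclideanSpace ℝ (Fin N) → ℝ)) = fun x => ∑ i, iteratedFDeriv ℝ 2 φ x
      ![stdOrthonormalBasis ℝ (EuclideanSpace ℝ (Fin N)) i,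
        stdOrthonormalBasis ℝ (EuclideanSpace ℝ (Fin N)) i] := by
  rw [InnerProductSpace.laplacian_eq_iteratedFDeriv_stdOrthonormalBasis]

theorem memLp_laplacian (φ : 𝓓(Ω, ℝ)) :
    MemLp (Δ (φ : EuclideanSpace ℝ (Fin N) → ℝ)) 2
      (volume.restrict (Ω : Set (EuclideanSpace ℝ (Fin N)))) := by
  rw [laplacian_test_eq]
  have hc : Continuous (iteratedFDeriv ℝ 2 (φ : EuclideanSpace ℝ (Fin N) → ℝ)) :=
    (contDiff_two_of_test φ).continuous_iteratedFDeriv le_rfl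
  refine Continuous.memLp_of_hasCompactSupport (by fun_prop) ?_
  refine (φ.hasCompactSupport.iteratedFDeriv (𝕜 := ℝ) 2).mono ?_
  intro x hx
  contrapose! hx
  simp only [Function.mem_support, not_not] at hx ⊢
  simp [hx]

/-- The inclusion `C_c^∞(Ω) → L²(Ω)`. -/
def testToL2 (Ω : Opens (EuclideanSpace ℝ (Fin N))) : 𝓓(Ω, ℝ) →ₗ[ℝ] L2 Ω where
  toFun φ := (memLp_of_test φ).toLp φ
  map_add' _ _ := rfl
  map_smul' _ _ := rfl

/-- The map `φ ↦ -Δφ` from `C_c^∞(Ω)` to `L²(Ω)`, with the classical Laplacian. -/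
def negLaplacianTest (Ω : Opens (EuclideanSpace ℝ (Fin N))) : 𝓓(Ω, ℝ) →ₗ[ℝ] L2 Ω where
  toFun φ := -(memLp_laplacian φ).toLp (Δ (φ : EuclideanSpace ℝ (Fin N) → ℝ))
  map_add' φ ψ := by
    rw [← neg_add, ← MemLp.toLp_add, neg_inj]
    congr 1
    funext x
    exact (contDiff_two_of_test φ).contDiffAt.laplacian_add (contDiff_two_of_test ψ).contDiffAt
  map_smul' c φ := by
    rw [RingHom.id_apply, smul_neg, ← MemLp.toLp_const_smul, neg_inj]
    congr 1
    funext x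
    exact InnerProductSpace.laplacian_smul c (contDiff_two_of_test φ).contDiffAt

theorem testToL2_injective (Ω : Opens (EuclideanSpace ℝ (Fin N))) :
    Function.Injective (testToL2 Ω) := by
  rw [← LinearMap.ker_eq_bot, LinearMap.ker_eq_bot']
  intro φ hφ
  have h1 : (φ : EuclideanSpace ℝ (Fin N) → ℝ)
      =ᵐ[volume.restrict (Ω : Set (EuclideanSpace ℝ (Fin N)))] 0 :=
    (MemLp.toLp_eq_toLp_iff (memLp_of_test φ) (MemLp.zero (ε := ℝ))).1 hφ
  have h2 := Measure.eqOn_open_of_ae_eq h1 Ω.isOpen φ.continuous.continuousOn continuousOn_const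
  ext x
  by_cases hx : x ∈ (Ω : Set (EuclideanSpace ℝ (Fin N)))
  · exact h2 hx
  · exact image_eq_zero_of_notMem_tsupport fun h => hx (φ.tsupport_subset h)

/-- The classical Dirichlet-Laplace operator `T₀ = -Δ` with domain `C_c^∞(Ω)`, given by its
graph `{(φ, -Δφ) | φ ∈ C_c^∞(Ω)}`. -/
def classicalLaplacian (Ω : Opens (EuclideanSpace ℝ (Fin N))) : L2 Ω →ₗ.[ℝ] L2 Ω :=
  (LinearMap.range ((testToL2 Ω).prod (negLaplacianTest Ω))).toLinearPMap

/-- The graph is that of an operator. -/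
theorem mem_graph_classicalLaplacian (p : L2 Ω × L2 Ω) :
    p ∈ (classicalLaplacian Ω).graph ↔ ∃ φ : 𝓓(Ω, ℝ), (testToL2 Ω φ, negLaplacianTest Ω φ) = p := by
  rw [classicalLaplacian, Submodule.toLinearPMap_graph_eq]
  · rfl
  · rintro _ ⟨φ, rfl⟩ h
    have : φ = 0 := testToL2_injective Ω (by simpa using h)
    simp [this]

/-- `g` is the `i`-th weak partial derivative of `u` in `Ω`. -/
def HasWeakPartial (i : Fin N) (u g : L2 Ω) : Prop :=
  ∀ φ : 𝓓(Ω, ℝ), ∫ x in (Ω : Set (EuclideanSpace ℝ (Fin N))),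
      u x * fderiv ℝ φ x (EuclideanSpace.single i 1) =
    -∫ x in (Ω : Set (EuclideanSpace ℝ (Fin N))), g x * φ x

open Classical in
/-- The `i`-th weak partial derivative of `u`, if `u` has one in `L²(Ω)` (and `0` otherwise). -/
def weakPartial (i : Fin N) (u : L2 Ω) : L2 Ω :=
  if h : ∃ g, HasWeakPartial i u g then h.choose else 0

theorem inner_testToL2 (g : L2 Ω) (φ : 𝓓(Ω, ℝ)) :
    ⟪g, testToL2 Ω φ⟫_ℝ = ∫ x in (Ω : Set (EuclideanSpace ℝ (Fin N))), g x * φ x := by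
  rw [L2.inner_def]
  refine integral_congr_ae ?_
  filter_upwards [(memLp_of_test φ).coeFn_toLp] with x hx
  change ⟪g x, (memLp_of_test φ).toLp φ x⟫_ℝ = _
  rw [hx]
  simp [mul_comm]

/-- The fundamental lemma of the calculus of variations in `L²(Ω)`. -/
theorem eq_zero_of_inner_test (g : L2 Ω) (h : ∀ φ : 𝓓(Ω, ℝ), ⟪g, testToL2 Ω φ⟫_ℝ = 0) :
    g = 0 := by
  rw [Lp.eq_zero_iff_ae_eq_zero]
  have hloc : LocallyIntegrableOn (g : EuclideanSpace ℝ (Fin N) → ℝ) (Ω : Set _) volume := by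
    refine (locallyIntegrableOn_iff Ω.isOpen.isLocallyClosed).2 fun K hK hc => ?_
    have h1 := ((Lp.memLp g).mono_measure (Measure.restrict_mono hK le_rfl))
    have : IsFiniteMeasure (volume.restrict K) := ⟨by simpa using hc.measure_lt_top⟩
    exact h1.integrable (by norm_num)
  have h3 := Ω.isOpen.ae_eq_zero_of_integral_contDiff_smul_eq_zero hloc fun φ h1 h2 h3 => by
    have h4 := h ⟨φ, h1, h2, h3⟩
    rw [inner_testToL2] at h4
    rw [← setIntegral_eq_integral_of_forall_compl_eq_zero (s := (Ω : Set _)), ← h4]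
    · exact integral_congr_ae (.of_forall fun x => mul_comm _ _)
    · intro x hx
      rw [image_eq_zero_of_notMem_tsupport fun h => hx (h3 h), zero_smul]
  exact (ae_restrict_iff' Ω.isOpen.measurableSet).2 h3

theorem integrable_mul_deriv (i : Fin N) (u : L2 Ω) (φ : 𝓓(Ω, ℝ)) :
    IntegrableOn (fun x => u x * fderiv ℝ φ x (EuclideanSpace.single i 1))
      (Ω : Set (EuclideanSpace ℝ (Fin N))) := by
  refine MemLp.integrable_mul (Lp.memLp u) ?_ (p := 2) (q := 2)
  have hc : Continuous (fderiv ℝ (φ : EuclideanSpace ℝ (Fin N) → ℝ)) :=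
    (contDiff_two_of_test φ).continuous_fderiv (by norm_num)
  exact Continuous.memLp_of_hasCompactSupport (by fun_prop)
    (φ.hasCompactSupport.fderiv_apply (𝕜 := ℝ) _)

theorem HasWeakPartial.unique {i : Fin N} {u g g' : L2 Ω} (h : HasWeakPartial i u g)
    (h' : HasWeakPartial i u g') : g = g' := by
  rw [← sub_eq_zero]
  refine eq_zero_of_inner_test _ fun φ => ?_
  rw [inner_sub_left, inner_testToL2, inner_testToL2, sub_eq_zero, ← neg_inj, ← h φ, ← h' φ]

theorem HasWeakPartial.weakPartial_eq {i : Fin N} {u g : L2 Ω} (h : HasWeakPartial i u g) :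
    weakPartial i u = g := by
  have h' : ∃ g, HasWeakPartial i u g := ⟨g, h⟩
  rw [weakPartial, dif_pos h']
  exact h'.choose_spec.unique h

theorem hasWeakPartial_weakPartial {i : Fin N} {u : L2 Ω} (h : ∃ g, HasWeakPartial i u g) :
    HasWeakPartial i u (weakPartial i u) := by
  rw [weakPartial, dif_pos h]
  exact h.choose_spec

theorem hasWeakPartial_iff_inner {i : Fin N} {u g : L2 Ω} :
    HasWeakPartial i u g ↔ ∀ φ : 𝓓(Ω, ℝ), ∫ x in (Ω : Set (EuclideanSpace ℝ (Fin N))),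
      u x * fderiv ℝ φ x (EuclideanSpace.single i 1) = -⟪g, testToL2 Ω φ⟫_ℝ := by
  simp only [HasWeakPartial, inner_testToL2]

theorem HasWeakPartial.add {i : Fin N} {u u' g g' : L2 Ω} (h : HasWeakPartial i u g)
    (h' : HasWeakPartial i u' g') : HasWeakPartial i (u + u') (g + g') := by
  rw [hasWeakPartial_iff_inner] at *
  intro φ
  rw [inner_add_left, neg_add, ← h φ, ← h' φ,
    ← integral_add (integrable_mul_deriv i u φ) (integrable_mul_deriv i u' φ)]
  refine integral_congr_ae ?_
  filter_upwards [Lp.coeFn_add u u'] with x hx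
  rw [hx, Pi.add_apply, add_mul]

theorem HasWeakPartial.smul {i : Fin N} {u g : L2 Ω} (c : ℝ) (h : HasWeakPartial i u g) :
    HasWeakPartial i (c • u) (c • g) := by
  rw [hasWeakPartial_iff_inner] at *
  intro φ
  rw [real_inner_smul_left, ← mul_neg, ← h φ, ← integral_const_mul]
  refine integral_congr_ae ?_
  filter_upwards [Lp.coeFn_smul c u] with x hx
  rw [hx, Pi.smul_apply, smul_eq_mul, mul_assoc]

theorem HasWeakPartial.zero (i : Fin N) : HasWeakPartial i (0 : L2 Ω) 0 := by
  intro φ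
  have h0 := Lp.coeFn_zero ℝ 2 (volume.restrict (Ω : Set (EuclideanSpace ℝ (Fin N))))
  rw [integral_eq_zero_of_ae, integral_eq_zero_of_ae, neg_zero]
  all_goals
    filter_upwards [h0] with x hx
    rw [hx]
    simp

/-- The Sobolev space `H¹(Ω) = W^{1,2}(Ω)`. -/
def H1 (Ω : Opens (EuclideanSpace ℝ (Fin N))) : Submodule ℝ (L2 Ω) where
  carrier := {u | ∀ i, ∃ g, HasWeakPartial i u g}
  add_mem' hu hv i := ⟨_, (hu i).choose_spec.add (hv i).choose_spec⟩
  zero_mem' i := ⟨0, .zero i⟩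
  smul_mem' c _ hu i := ⟨_, (hu i).choose_spec.smul c⟩

theorem weakPartial_add (i : Fin N) {u v : L2 Ω} (hu : u ∈ H1 Ω) (hv : v ∈ H1 Ω) :
    weakPartial i (u + v) = weakPartial i u + weakPartial i v :=
  ((hasWeakPartial_weakPartial (hu i)).add (hasWeakPartial_weakPartial (hv i))).weakPartial_eq

theorem weakPartial_smul (i : Fin N) (c : ℝ) {u : L2 Ω} (hu : u ∈ H1 Ω) :
    weakPartial i (c • u) = c • weakPartial i u :=
  ((hasWeakPartial_weakPartial (hu i)).smul c).weakPartial_eq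

theorem weakPartial_zero (i : Fin N) : weakPartial i (0 : L2 Ω) = 0 :=
  (HasWeakPartial.zero i).weakPartial_eq

/-- The Sobolev space `H²(Ω) = W^{2,2}(Ω)`: all weak partial derivatives of order at most two are
in `L²(Ω)`. -/
def H2 (Ω : Opens (EuclideanSpace ℝ (Fin N))) : Submodule ℝ (L2 Ω) where
  carrier := {u | u ∈ H1 Ω ∧ ∀ i, weakPartial i u ∈ H1 Ω}
  add_mem' hu hv := ⟨add_mem hu.1 hv.1, fun i => by
    rw [weakPartial_add i hu.1 hv.1]; exact add_mem (hu.2 i) (hv.2 i)⟩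
  zero_mem' := ⟨zero_mem _, fun i => by rw [weakPartial_zero]; exact zero_mem _⟩
  smul_mem' c _ hu := ⟨(H1 Ω).smul_mem c hu.1, fun i => by
    rw [weakPartial_smul i c hu.1]; exact (H1 Ω).smul_mem c (hu.2 i)⟩

/-- The Dirichlet form `∫_Ω ∇u · ∇v` (for `u`, `v` in `H¹(Ω)`). -/
def dirichletForm (u v : L2 Ω) : ℝ :=
  ∫ x in (Ω : Set (EuclideanSpace ℝ (Fin N))), ∑ i, weakPartial i u x * weakPartial i v x

theorem dirichletForm_eq (u v : L2 Ω) :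
    dirichletForm u v = ∑ i, ⟪weakPartial i u, weakPartial i v⟫_ℝ := by
  rw [dirichletForm, integral_finsetSum _ fun i _ =>
    MemLp.integrable_mul (Lp.memLp _) (Lp.memLp _) (p := 2) (q := 2)]
  refine Finset.sum_congr rfl fun i _ => ?_
  rw [L2.inner_def]
  exact integral_congr_ae (.of_forall fun x => by simp [mul_comm])

theorem dirichletForm_add_left {u u' : L2 Ω} (hu : u ∈ H1 Ω) (hu' : u' ∈ H1 Ω) (v : L2 Ω) :
    dirichletForm (u + u') v = dirichletForm u v + dirichletForm u' v := by
  simp only [dirichletForm_eq, weakPartial_add _ hu hu', inner_add_left, Finset.sum_add_distrib]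

theorem dirichletForm_smul_left (c : ℝ) {u : L2 Ω} (hu : u ∈ H1 Ω) (v : L2 Ω) :
    dirichletForm (c • u) v = c * dirichletForm u v := by
  simp only [dirichletForm_eq, weakPartial_smul _ c hu, real_inner_smul_left, Finset.mul_sum]

theorem memLp_fderiv_test (i : Fin N) (φ : 𝓓(Ω, ℝ)) :
    MemLp (fun x => fderiv ℝ φ x (EuclideanSpace.single i 1)) 2
      (volume.restrict (Ω : Set (EuclideanSpace ℝ (Fin N)))) := by
  have hc : Continuous (fderiv ℝ (φ : EuclideanSpace ℝ (Fin N) → ℝ)) :=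
    (contDiff_two_of_test φ).continuous_fderiv (by norm_num)
  exact Continuous.memLp_of_hasCompactSupport (by fun_prop)
    (φ.hasCompactSupport.fderiv_apply (𝕜 := ℝ) _)

/-- The weak partial derivatives of a test function are the classical ones. -/
theorem hasWeakPartial_test (i : Fin N) (φ : 𝓓(Ω, ℝ)) :
    HasWeakPartial i (testToL2 Ω φ) ((memLp_fderiv_test i φ).toLp _) := by
  intro ψ
  have hφ : Continuous (fun x => fderiv ℝ φ x (EuclideanSpace.single i (1 : ℝ))) := by
    have := (contDiff_two_of_test φ).continuous_fderiv (by norm_num)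
    fun_prop
  have hψ : Continuous (fun x => fderiv ℝ ψ x (EuclideanSpace.single i (1 : ℝ))) := by
    have := (contDiff_two_of_test ψ).continuous_fderiv (by norm_num)
    fun_prop
  have key := integral_mul_fderiv_eq_neg_fderiv_mul_of_integrable (𝕜 := ℝ) (μ := volume)
    (f := φ) (g := ψ) (v := EuclideanSpace.single i (1 : ℝ))
    ((hφ.mul ψ.continuous).integrable_of_hasCompactSupport ψ.hasCompactSupport.mul_left)
    ((φ.continuous.mul hψ).integrable_of_hasCompactSupport φ.hasCompactSupport.mul_right)
    ((φ.continuous.mul ψ.continuous).integrable_of_hasCompactSupport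
      φ.hasCompactSupport.mul_right)
    (fun x _ => (contDiff_two_of_test φ).differentiable (by norm_num) x)
    (fun x _ => (contDiff_two_of_test ψ).differentiable (by norm_num) x)
  rw [← setIntegral_eq_integral_of_forall_compl_eq_zero (s := (Ω : Set _)),
    ← setIntegral_eq_integral_of_forall_compl_eq_zero (s := (Ω : Set _))
      (f := fun x => fderiv ℝ φ x (EuclideanSpace.single i (1 : ℝ)) * ψ x)] at key
  · refine Eq.trans (integral_congr_ae ?_) (key.trans (neg_inj.2 (integral_congr_ae ?_)))
    · filter_upwards [(memLp_of_test φ).coeFn_toLp] with x hx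
      change (memLp_of_test φ).toLp φ x * _ = _
      rw [hx]
    · filter_upwards [(memLp_fderiv_test i φ).coeFn_toLp] with x hx
      rw [hx]
  · intro x hx
    rw [image_eq_zero_of_notMem_tsupport fun h => hx (ψ.tsupport_subset h), mul_zero]
  · intro x hx
    rw [image_eq_zero_of_notMem_tsupport fun h => hx (φ.tsupport_subset h), zero_mul]

theorem testToL2_mem_H1 (φ : 𝓓(Ω, ℝ)) : testToL2 Ω φ ∈ H1 Ω :=
  fun i => ⟨_, hasWeakPartial_test i φ⟩

/-- The Sobolev space `H¹₀(Ω)`, the closure of `C_c^∞(Ω)` in `H¹(Ω)`: there are `φₙ ∈ C_c^∞(Ω)`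
with `φₙ → u` and `∇φₙ → ∇u` in `L²`. -/
def H10 (Ω : Opens (EuclideanSpace ℝ (Fin N))) : Submodule ℝ (L2 Ω) where
  carrier := {u | u ∈ H1 Ω ∧ ∃ φ : ℕ → 𝓓(Ω, ℝ),
    Tendsto (fun n => testToL2 Ω (φ n)) atTop (𝓝 u) ∧
    ∀ i, Tendsto (fun n => weakPartial i (testToL2 Ω (φ n))) atTop (𝓝 (weakPartial i u))}
  add_mem' := by
    rintro u v ⟨hu, φ, hφ, hφ'⟩ ⟨hv, ψ, hψ, hψ'⟩
    refine ⟨add_mem hu hv, fun n => φ n + ψ n, ?_, fun i => ?_⟩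
    · simpa only [map_add] using hφ.add hψ
    · rw [weakPartial_add i hu hv]
      simpa only [map_add, weakPartial_add i (testToL2_mem_H1 _) (testToL2_mem_H1 _)]
        using (hφ' i).add (hψ' i)
  zero_mem' := by
    refine ⟨zero_mem _, fun _ => 0, ?_, fun i => ?_⟩
    · simpa only [map_zero] using tendsto_const_nhds
    · simpa only [map_zero] using tendsto_const_nhds
  smul_mem' := by
    rintro c u ⟨hu, φ, hφ, hφ'⟩
    refine ⟨(H1 Ω).smul_mem c hu, fun n => c • φ n, ?_, fun i => ?_⟩
    · simpa only [map_smul] using hφ.const_smul c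
    · rw [weakPartial_smul i c hu]
      simpa only [map_smul, weakPartial_smul i c (testToL2_mem_H1 _)] using (hφ' i).const_smul c

theorem testToL2_mem_H10 (φ : 𝓓(Ω, ℝ)) : testToL2 Ω φ ∈ H10 Ω :=
  ⟨testToL2_mem_H1 φ, fun _ => φ, tendsto_const_nhds, fun _ => tendsto_const_nhds⟩

/-- The strong Dirichlet-Laplacian `-Δ u = -∑ᵢ ∂ᵢ∂ᵢ u` with domain `H¹₀(Ω) ∩ H²(Ω)`. -/
def strongLaplacian (Ω : Opens (EuclideanSpace ℝ (Fin N))) : L2 Ω →ₗ.[ℝ] L2 Ω where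
  domain := H10 Ω ⊓ H2 Ω
  toFun :=
    { toFun := fun u => -∑ i, weakPartial i (weakPartial i (u : L2 Ω))
      map_add' := fun u v => by
        simp only [Submodule.coe_add, weakPartial_add _ u.2.2.1 v.2.2.1,
          weakPartial_add _ (u.2.2.2 _) (v.2.2.2 _), Finset.sum_add_distrib, neg_add]
      map_smul' := fun c u => by
        simp only [Submodule.coe_smul, weakPartial_smul _ c u.2.2.1,
          weakPartial_smul _ c (u.2.2.2 _), ← Finset.smul_sum, smul_neg, RingHom.id_apply] }

/-- The graph of the weak Dirichlet-Laplacian: all `(u, g)` with `u ∈ H¹₀(Ω)`, `g ∈ L²(Ω)` and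
`∫_Ω ∇u · ∇v = ∫_Ω g v = ⟪g, v⟫` for every `v ∈ H¹₀(Ω)`. -/
def weakLaplacianGraph (Ω : Opens (EuclideanSpace ℝ (Fin N))) :
    Submodule ℝ (L2 Ω × L2 Ω) where
  carrier := {p | p.1 ∈ H10 Ω ∧ ∀ v ∈ H10 Ω, dirichletForm p.1 v = ⟪p.2, v⟫_ℝ}
  add_mem' := by
    rintro p q ⟨hp, hp'⟩ ⟨hq, hq'⟩
    refine ⟨add_mem hp hq, fun v hv => ?_⟩
    rw [Prod.fst_add, Prod.snd_add, dirichletForm_add_left hp.1 hq.1, hp' v hv, hq' v hv,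
      inner_add_left]
  zero_mem' := by
    refine ⟨zero_mem _, fun v _ => ?_⟩
    simp [dirichletForm_eq, weakPartial_zero]
  smul_mem' := by
    rintro c p ⟨hp, hp'⟩
    refine ⟨(H10 Ω).smul_mem c hp, fun v hv => ?_⟩
    rw [Prod.smul_fst, Prod.smul_snd, dirichletForm_smul_left c hp.1, hp' v hv,
      real_inner_smul_left]

/-- The weak Dirichlet-Laplace operator `(-Δ)_ω`. -/
def weakLaplacian (Ω : Opens (EuclideanSpace ℝ (Fin N))) : L2 Ω →ₗ.[ℝ] L2 Ω :=
  (weakLaplacianGraph Ω).toLinearPMap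

/-- The graph is that of an operator. -/
theorem mem_graph_weakLaplacian (p : L2 Ω × L2 Ω) :
    p ∈ (weakLaplacian Ω).graph ↔
      p.1 ∈ H10 Ω ∧ ∀ v ∈ H10 Ω, dirichletForm p.1 v = ⟪p.2, v⟫_ℝ := by
  rw [weakLaplacian, Submodule.toLinearPMap_graph_eq]
  · rfl
  · rintro ⟨u, g⟩ ⟨_, h⟩ (rfl : u = 0)
    refine eq_zero_of_inner_test g fun φ => ?_
    rw [← h _ (testToL2_mem_H10 φ)]
    simp [dirichletForm_eq, weakPartial_zero]

end Dirichlet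

end

open Friedrichs Dirichlet

/-!
The argument has three ingredients.

*Closedness of weak derivatives.* If test functions `φₙ` converge to `u` in `L²` and their partial
derivatives converge to `gᵢ` in `L²`, then `∂ᵢu = gᵢ` weakly and `u ∈ H¹₀`
(`mem_H10_of_tendsto`). As the form of `T₀` is the Dirichlet form on test functions
(`form_classicalLaplacian`), energy-Cauchy sequences are those whose gradients are Cauchy in `L²`;
so the form domain is `H¹₀` and the inner product of the form domain is the Dirichlet form.

*Poincaré's inequality* (`exists_norm_testToL2_le`), obtained by testing the weak derivative of `φ`
against `xᵢ φ`: `‖φ‖² = -2 ⟪∂ᵢφ, xᵢφ⟫ ≤ 2R ‖φ‖ ‖∂ᵢφ‖`, where `|xᵢ| ≤ R` on `Ω`. It gives the lower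
bound for `T₀`, the injectivity of the weak Laplacian, and, by Riesz' theorem in the closure of the
space of gradients of test functions, its surjectivity (`exists_dirichletForm_eq_inner`).

*Operator theory.* A densely defined symmetric operator that is onto is self-adjoint
(`LinearPMap.adjoint_eq_self_of_surjective`). A functional `⟪u, ·⟫_V` that is continuous for the
topology of `L²` is represented by an element of `L²`, which identifies the Friedrichs extension
with the weak Laplacian. The inclusions `T₀ ⊂ -Δ ⊂ (-Δ)_ω` are integration by parts, extended from
test functions to `H¹₀` by density.
-/

open Friedrichs Dirichlet

/-! ### Hilbert space preliminaries -/

/-- A continuous linear functional on a subspace of a Hilbert space is represented by a vector of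
the whole space. -/
theorem Submodule.exists_inner_eq_of_continuous {H : Type*} [NormedAddCommGroup H]
    [InnerProductSpace ℝ H] [CompleteSpace H] (p : Submodule ℝ H) (f : p →ₗ[ℝ] ℝ)
    (hf : Continuous f) : ∃ g : H, ∀ v : p, f v = ⟪g, (v : H)⟫_ℝ := by
  obtain ⟨F, hF, -⟩ := exists_extension_norm_eq (𝕜 := ℝ) p (⟨f, hf⟩ : StrongDual ℝ p)
  refine ⟨(InnerProductSpace.toDual ℝ H).symm F, fun v => ?_⟩
  rw [InnerProductSpace.toDual_symm_apply, hF v]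
  rfl

/-- A functional `ℓ` that is bounded by `‖A ·‖` has the form `⟪w, A ·⟫` with `w` in the closure of
the range of `A`. -/
theorem LinearMap.exists_mem_closure_range_inner_eq {X E : Type*} [AddCommGroup X] [Module ℝ X]
    [NormedAddCommGroup E] [InnerProductSpace ℝ E] [CompleteSpace E] (A : X →ₗ[ℝ] E)
    (l : X →ₗ[ℝ] ℝ) (C : ℝ) (hl : ∀ x, ‖l x‖ ≤ C * ‖A x‖) :
    ∃ w ∈ closure (Set.range A), ∀ x, ⟪w, A x⟫_ℝ = l x := by
  obtain ⟨s, hs⟩ := A.rangeRestrict.exists_rightInverse_of_surjective A.range_rangeRestrict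
  have hs' (y : LinearMap.range A) : A (s y) = y :=
    congrArg Subtype.val (LinearMap.congr_fun hs y)
  have hbound (y : LinearMap.range A) : ‖(l.comp s) y‖ ≤ C * ‖y‖ := by
    simpa [hs'] using hl (s y)
  obtain ⟨f, hf⟩ := (LinearMap.range A).exists_inner_eq_of_continuous (l.comp s)
    ((l.comp s).mkContinuous C hbound).continuous
  set K := (LinearMap.range A).topologicalClosure
  have : CompleteSpace K := (LinearMap.range A).isClosed_topologicalClosure.completeSpace_coe
  refine ⟨K.starProjection f, ?_, fun x => ?_⟩
  · rw [← LinearMap.coe_range, ← Submodule.topologicalClosure_coe]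
    exact K.starProjection_apply_mem f
  · have hx : A x ∈ K := (LinearMap.range A).le_topologicalClosure ⟨x, rfl⟩
    have h1 : ⟪K.starProjection f, A x⟫_ℝ = ⟪f, A x⟫_ℝ := by
      rw [Submodule.inner_starProjection_left_eq_right, Submodule.starProjection_eq_self_iff.2 hx]
    have h2 : l (s ⟨A x, x, rfl⟩) = ⟪f, A x⟫_ℝ := hf ⟨A x, x, rfl⟩
    -- `l` vanishes on the kernel of `A`, hence does not see the choice of the section `s`
    have h3 : ‖l (s ⟨A x, x, rfl⟩ - x)‖ ≤ 0 := by simpa [hs'] using hl (s ⟨A x, x, rfl⟩ - x)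
    rw [norm_le_zero_iff, map_sub, sub_eq_zero] at h3
    rw [h1, ← h2, h3]

/-- A densely defined symmetric operator that is onto is self-adjoint. -/
theorem LinearPMap.adjoint_eq_self_of_surjective {H : Type*} [NormedAddCommGroup H]
    [InnerProductSpace ℝ H] [CompleteSpace H] {A : H →ₗ.[ℝ] H} (hd : Dense (A.domain : Set H))
    (hs : A.IsFormalAdjoint A) (hsurj : Function.Surjective fun u : A.domain => A u) :
    A† = A := by
  have hle : A ≤ A† := hs.le_adjoint hd
  refine (LinearPMap.eq_of_le_of_domain_eq hle (le_antisymm hle.1 fun u hu => ?_)).symm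
  obtain ⟨v, hv⟩ := hsurj (A† ⟨u, hu⟩)
  suffices h : u = v from h ▸ v.2
  refine ext_inner_right ℝ fun y => ?_
  obtain ⟨x, rfl⟩ := hsurj y
  have h1 := LinearPMap.adjoint_isFormalAdjoint hd ⟨u, hu⟩ x
  have h2 := hs v x
  dsimp only at hv h1 ⊢
  rw [← h1, ← h2, hv]

namespace Dirichlet

variable {N : ℕ} {Ω : Opens (EuclideanSpace ℝ (Fin N))}

/-! ### Operations on test functions -/

/-- The `i`-th classical partial derivative as a linear map on `C_c^∞(Ω)`. -/
noncomputable def partialTest (i : Fin N) : 𝓓(Ω, ℝ) →ₗ[ℝ] 𝓓(Ω, ℝ) where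
  toFun φ := ⟨fun x => fderiv ℝ φ x (EuclideanSpace.single i 1),
    (φ.contDiff.fderiv_right (m := ∞) (by simp)).clm_apply contDiff_const,
    φ.hasCompactSupport.fderiv_apply (𝕜 := ℝ) _,
    (tsupport_fderiv_apply_subset ℝ _).trans φ.tsupport_subset⟩
  map_add' φ ψ := by
    ext x
    change fderiv ℝ (⇑φ + ⇑ψ) x _ = fderiv ℝ φ x _ + fderiv ℝ ψ x _
    rw [fderiv_add ((contDiff_two_of_test φ).differentiable (by norm_num) x)
      ((contDiff_two_of_test ψ).differentiable (by norm_num) x)]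
    rfl
  map_smul' c φ := by
    ext x
    change fderiv ℝ (c • ⇑φ) x _ = c • fderiv ℝ φ x _
    rw [fderiv_const_smul ((contDiff_two_of_test φ).differentiable (by norm_num) x)]
    rfl

theorem partialTest_apply (i : Fin N) (φ : 𝓓(Ω, ℝ)) (x : EuclideanSpace ℝ (Fin N)) :
    partialTest i φ x = fderiv ℝ φ x (EuclideanSpace.single i 1) := rfl

/-- Multiplication of a test function by the coordinate `xᵢ`. -/
noncomputable def coordMul (i : Fin N) (φ : 𝓓(Ω, ℝ)) : 𝓓(Ω, ℝ) :=
  ⟨fun x => x i * φ x, (contDiff_piLp_apply (p := 2)).mul φ.contDiff, φ.hasCompactSupport.mul_left,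
    (tsupport_mul_subset_right).trans φ.tsupport_subset⟩

theorem coordMul_apply (i : Fin N) (φ : 𝓓(Ω, ℝ)) (x : EuclideanSpace ℝ (Fin N)) :
    coordMul i φ x = x i * φ x := rfl

theorem partialTest_coordMul (i : Fin N) (φ : 𝓓(Ω, ℝ)) :
    partialTest i (coordMul i φ) = φ + coordMul i (partialTest i φ) := by
  ext x
  have h1 : HasFDerivAt (fun x : EuclideanSpace ℝ (Fin N) => x i)
      (EuclideanSpace.proj i : EuclideanSpace ℝ (Fin N) →L[ℝ] ℝ) x :=
    (EuclideanSpace.proj i : EuclideanSpace ℝ (Fin N) →L[ℝ] ℝ).hasFDerivAt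
  have h2 := ((contDiff_two_of_test φ).differentiable (by norm_num) x).hasFDerivAt
  have h3 : fderiv ℝ (coordMul i φ : EuclideanSpace ℝ (Fin N) → ℝ) x = _ := (h1.mul h2).fderiv
  rw [partialTest_apply, h3]
  change _ = φ x + x i * fderiv ℝ φ x _
  simp
  ring

theorem coeFn_testToL2 (φ : 𝓓(Ω, ℝ)) :
    testToL2 Ω φ =ᵐ[volume.restrict (Ω : Set (EuclideanSpace ℝ (Fin N)))] φ :=
  (memLp_of_test φ).coeFn_toLp

theorem weakPartial_testToL2 (i : Fin N) (φ : 𝓓(Ω, ℝ)) :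
    weakPartial i (testToL2 Ω φ) = testToL2 Ω (partialTest i φ) :=
  (hasWeakPartial_test i φ).weakPartial_eq

theorem negLaplacianTest_eq (φ : 𝓓(Ω, ℝ)) :
    negLaplacianTest Ω φ = -∑ i, testToL2 Ω (partialTest i (partialTest i φ)) := by
  rw [← map_sum]
  change -(memLp_laplacian φ).toLp _ = -(memLp_of_test _).toLp _
  rw [neg_inj]
  congr 1
  rw [InnerProductSpace.laplacian_eq_iteratedFDeriv_orthonormalBasis _
    (EuclideanSpace.basisFun (Fin N) ℝ)]
  funext x
  rw [_root_.sum_apply]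
  refine Finset.sum_congr rfl fun i _ => ?_
  rw [iteratedFDeriv_two_apply]
  have hd : DifferentiableAt ℝ (fderiv ℝ (φ : EuclideanSpace ℝ (Fin N) → ℝ)) x :=
    ((contDiff_two_of_test φ).fderiv_right (m := 1) (by norm_num)).differentiable (by norm_num) x
  change _ = fderiv ℝ (fun y => fderiv ℝ φ y (EuclideanSpace.single i 1)) x _
  rw [fderiv_clm_apply hd (differentiableAt_const _)]
  simp

/-! ### Weak derivatives and the Dirichlet form -/

theorem hasWeakPartial_iff {i : Fin N} {u g : L2 Ω} : HasWeakPartial i u g ↔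
    ∀ φ : 𝓓(Ω, ℝ), ⟪u, testToL2 Ω (partialTest i φ)⟫_ℝ = -⟪g, testToL2 Ω φ⟫_ℝ := by
  simp only [hasWeakPartial_iff_inner, inner_testToL2, partialTest_apply]

/-- Weak differentiation is closed: an `L²` limit of test functions whose partial derivatives
converge in `L²` lies in `H¹₀`, and its weak partial derivatives are the limits. -/
theorem mem_H10_of_tendsto {u : L2 Ω} {g : Fin N → L2 Ω} {φ : ℕ → 𝓓(Ω, ℝ)}
    (hφ : Tendsto (fun n => testToL2 Ω (φ n)) atTop (𝓝 u))
    (hg : ∀ i, Tendsto (fun n => weakPartial i (testToL2 Ω (φ n))) atTop (𝓝 (g i))) :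
    u ∈ H10 Ω ∧ ∀ i, weakPartial i u = g i := by
  have h (i) : HasWeakPartial i u (g i) := by
    rw [hasWeakPartial_iff]
    intro ψ
    refine tendsto_nhds_unique (hφ.inner tendsto_const_nhds) ?_
    refine Tendsto.congr (fun n => ?_) ((hg i).inner (tendsto_const_nhds (x := testToL2 Ω ψ))).neg
    exact (hasWeakPartial_iff.1 (hasWeakPartial_weakPartial (testToL2_mem_H1 (φ n) i)) ψ).symm
  refine ⟨⟨fun i => ⟨g i, h i⟩, φ, hφ, fun i => ?_⟩, fun i => (h i).weakPartial_eq⟩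
  rw [(h i).weakPartial_eq]
  exact hg i

theorem dirichletForm_comm (u v : L2 Ω) : dirichletForm u v = dirichletForm v u := by
  simp only [dirichletForm_eq, real_inner_comm]

theorem tendsto_dirichletForm {a b : ℕ → L2 Ω} {u v : L2 Ω}
    (ha : ∀ i, Tendsto (fun n => weakPartial i (a n)) atTop (𝓝 (weakPartial i u)))
    (hb : ∀ i, Tendsto (fun n => weakPartial i (b n)) atTop (𝓝 (weakPartial i v))) :
    Tendsto (fun n => dirichletForm (a n) (b n)) atTop (𝓝 (dirichletForm u v)) := by
  simp only [dirichletForm_eq]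
  exact tendsto_finsetSum _ fun i _ => (ha i).inner (hb i)

/-- The equation of the weak Laplacian needs to be checked for test functions only. -/
theorem dirichletForm_eq_inner_of_forall_test {u g : L2 Ω}
    (h : ∀ φ : 𝓓(Ω, ℝ), dirichletForm u (testToL2 Ω φ) = ⟪g, testToL2 Ω φ⟫_ℝ)
    {v : L2 Ω} (hv : v ∈ H10 Ω) : dirichletForm u v = ⟪g, v⟫_ℝ := by
  obtain ⟨-, φ, hφ, hφ'⟩ := hv
  refine tendsto_nhds_unique (tendsto_dirichletForm (fun _ => tendsto_const_nhds) hφ') ?_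
  simp only [h]
  exact tendsto_const_nhds.inner hφ

theorem norm_weakPartial_le (i : Fin N) (u : L2 Ω) :
    ‖weakPartial i u‖ ≤ √(dirichletForm u u) := by
  refine Real.le_sqrt_of_sq_le ?_
  rw [dirichletForm_eq, ← real_inner_self_eq_norm_sq]
  exact Finset.single_le_sum (f := fun i => ⟪weakPartial i u, weakPartial i u⟫_ℝ)
    (fun _ _ => real_inner_self_nonneg) (Finset.mem_univ i)

/-- The gradient of a test function, as an element of the Hilbert space `L²(Ω)^N`. -/
noncomputable def gradTest (Ω : Opens (EuclideanSpace ℝ (Fin N))) :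
    𝓓(Ω, ℝ) →ₗ[ℝ] PiLp 2 fun _ : Fin N => L2 Ω where
  toFun φ := WithLp.toLp 2 fun i => testToL2 Ω (partialTest i φ)
  map_add' φ ψ := by
    ext1 i
    simp
  map_smul' c φ := by
    ext1 i
    simp

theorem gradTest_apply (φ : 𝓓(Ω, ℝ)) (i : Fin N) :
    gradTest Ω φ i = weakPartial i (testToL2 Ω φ) :=
  (weakPartial_testToL2 i φ).symm

theorem norm_gradTest_sq (φ : 𝓓(Ω, ℝ)) :
    ‖gradTest Ω φ‖ ^ 2 = dirichletForm (testToL2 Ω φ) (testToL2 Ω φ) := by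
  rw [← real_inner_self_eq_norm_sq, PiLp.inner_apply, dirichletForm_eq]
  simp only [gradTest_apply]

/-! ### Poincaré's inequality -/

theorem norm_coordMul_le {R : ℝ} (hR : ∀ x ∈ Ω, ‖x‖ ≤ R) (i : Fin N) (φ : 𝓓(Ω, ℝ)) :
    ‖testToL2 Ω (coordMul i φ)‖ ≤ R * ‖testToL2 Ω φ‖ := by
  refine Lp.norm_le_mul_norm_of_ae_le_mul ?_
  filter_upwards [coeFn_testToL2 φ, coeFn_testToL2 (coordMul i φ),
    ae_restrict_mem Ω.isOpen.measurableSet] with x h1 h2 hx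
  rw [h1, h2, coordMul_apply, norm_mul]
  gcongr
  exact (PiLp.norm_apply_le x i).trans (hR x hx)

/-- Poincaré's inequality in a bounded open set, in one coordinate direction. -/
theorem norm_testToL2_le_partialTest {R : ℝ} (hR0 : 0 ≤ R) (hR : ∀ x ∈ Ω, ‖x‖ ≤ R) (i : Fin N)
    (φ : 𝓓(Ω, ℝ)) :
    ‖testToL2 Ω φ‖ ≤ 2 * R * ‖testToL2 Ω (partialTest i φ)‖ := by
  set u := testToL2 Ω φ
  set d := testToL2 Ω (partialTest i φ)
  have h1 : ⟪u, testToL2 Ω (partialTest i (coordMul i φ))⟫_ℝ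
      = -⟪d, testToL2 Ω (coordMul i φ)⟫_ℝ :=
    hasWeakPartial_iff.1 (hasWeakPartial_test i φ) (coordMul i φ)
  have h2 : ⟪u, testToL2 Ω (coordMul i (partialTest i φ))⟫_ℝ
      = ⟪d, testToL2 Ω (coordMul i φ)⟫_ℝ := by
    rw [inner_testToL2, inner_testToL2]
    refine integral_congr_ae ?_
    filter_upwards [coeFn_testToL2 φ, coeFn_testToL2 (partialTest i φ)] with x h1 h2
    rw [h1, h2, coordMul_apply, coordMul_apply]
    ring
  rw [partialTest_coordMul, map_add, inner_add_right, h2, real_inner_self_eq_norm_sq] at h1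
  have h3 : -⟪d, testToL2 Ω (coordMul i φ)⟫_ℝ ≤ ‖d‖ * (R * ‖u‖) :=
    (neg_le_abs _).trans ((abs_real_inner_le_norm _ _).trans
      (mul_le_mul_of_nonneg_left (norm_coordMul_le hR i φ) (norm_nonneg _)))
  have h4 : ‖u‖ * ‖u‖ ≤ (2 * R * ‖d‖) * ‖u‖ := by linarith
  rcases (norm_nonneg u).eq_or_lt with h0 | h0
  · rw [← h0]
    positivity
  · exact le_of_mul_le_mul_right h4 h0

/-- Poincaré's inequality. -/
theorem exists_norm_testToL2_le (hN : 1 ≤ N)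
    (hΩ : Bornology.IsBounded (Ω : Set (EuclideanSpace ℝ (Fin N)))) :
    ∃ C > 0, ∀ φ : 𝓓(Ω, ℝ), ‖testToL2 Ω φ‖ ≤ C * ‖gradTest Ω φ‖ := by
  obtain ⟨R, hR0, hR⟩ := hΩ.exists_pos_norm_le
  refine ⟨2 * R, by positivity, fun φ => ?_⟩
  refine (norm_testToL2_le_partialTest hR0.le hR ⟨0, hN⟩ φ).trans ?_
  gcongr
  exact PiLp.norm_apply_le (gradTest Ω φ) ⟨0, hN⟩

theorem exists_norm_sq_le_dirichletForm (hN : 1 ≤ N)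
    (hΩ : Bornology.IsBounded (Ω : Set (EuclideanSpace ℝ (Fin N)))) :
    ∃ c > 0, ∀ u ∈ H10 Ω, c * ‖u‖ ^ 2 ≤ dirichletForm u u := by
  obtain ⟨C, hC, h⟩ := exists_norm_testToL2_le hN hΩ
  refine ⟨(C ^ 2)⁻¹, by positivity, ?_⟩
  rintro u ⟨-, φ, hφ, hφ'⟩
  refine le_of_tendsto_of_tendsto' ((hφ.norm.pow 2).const_mul _) (tendsto_dirichletForm hφ' hφ')
    fun n => ?_
  rw [inv_mul_le_iff₀ (by positivity), ← norm_gradTest_sq, ← mul_pow]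
  exact pow_le_pow_left₀ (norm_nonneg _) (h _) 2

/-- Weak solvability of the Dirichlet problem. -/
theorem exists_dirichletForm_eq_inner (hN : 1 ≤ N)
    (hΩ : Bornology.IsBounded (Ω : Set (EuclideanSpace ℝ (Fin N)))) (g : L2 Ω) :
    ∃ u ∈ H10 Ω, ∀ v ∈ H10 Ω, dirichletForm u v = ⟪g, v⟫_ℝ := by
  obtain ⟨C, hC, h⟩ := exists_norm_testToL2_le hN hΩ
  obtain ⟨w, hw, hwg⟩ := (gradTest Ω).exists_mem_closure_range_inner_eq
    ((innerₛₗ ℝ g).comp (testToL2 Ω)) (‖g‖ * C) fun φ => by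
      rw [mul_assoc]
      exact (norm_inner_le_norm g _).trans (mul_le_mul_of_nonneg_left (h φ) (norm_nonneg _))
  obtain ⟨s, hs, hsw⟩ := mem_closure_iff_seq_limit.1 hw
  choose φ hφ using hs
  obtain rfl : (fun n => gradTest Ω (φ n)) = s := funext hφ
  -- by Poincaré's inequality, convergence of the gradients implies that of the functions
  have hcau : CauchySeq fun n => testToL2 Ω (φ n) := by
    rw [cauchySeq_iff_tendsto_dist_atTop_0]
    have h0 := (cauchySeq_iff_tendsto_dist_atTop_0.1 hsw.cauchySeq).const_mul C
    rw [mul_zero] at h0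
    refine squeeze_zero (fun _ => dist_nonneg) (fun n => ?_) h0
    rw [dist_eq_norm, dist_eq_norm, ← map_sub, ← map_sub]
    exact h _
  obtain ⟨u, hu⟩ := cauchySeq_tendsto_of_complete hcau
  obtain ⟨huH, hug⟩ := mem_H10_of_tendsto hu (g := fun i => w i) fun i => by
    simp only [← gradTest_apply]
    exact ((PiLp.continuous_apply 2 _ i).tendsto w).comp hsw
  refine ⟨u, huH, fun v hv => dirichletForm_eq_inner_of_forall_test (fun ψ => ?_) hv⟩
  have h1 : ⟪w, gradTest Ω ψ⟫_ℝ = ⟪g, testToL2 Ω ψ⟫_ℝ := hwg ψ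
  rw [← h1, PiLp.inner_apply, dirichletForm_eq]
  simp only [gradTest_apply, hug]

/-! ### The three Laplacians -/

theorem mem_domain_classicalLaplacian {u : L2 Ω} :
    u ∈ (classicalLaplacian Ω).domain ↔ ∃ φ : 𝓓(Ω, ℝ), testToL2 Ω φ = u := by
  rw [LinearPMap.mem_domain_iff]
  simp only [mem_graph_classicalLaplacian, Prod.mk.injEq]
  exact ⟨fun ⟨_, φ, h, _⟩ => ⟨φ, h⟩, fun ⟨φ, h⟩ => ⟨_, φ, h, rfl⟩⟩

theorem dense_domain_classicalLaplacian :
    Dense ((classicalLaplacian Ω).domain : Set (L2 Ω)) := by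
  rw [Submodule.dense_iff_topologicalClosure_eq_top, Submodule.topologicalClosure_eq_top_iff,
    Submodule.eq_bot_iff]
  intro g hg
  refine eq_zero_of_inner_test g fun φ => ?_
  exact (Submodule.mem_orthogonal' _ _).1 hg _ (mem_domain_classicalLaplacian.2 ⟨φ, rfl⟩)

theorem classicalLaplacian_le_strongLaplacian :
    classicalLaplacian Ω ≤ strongLaplacian Ω := by
  refine LinearPMap.le_of_le_graph fun p hp => ?_
  obtain ⟨φ, rfl⟩ := (mem_graph_classicalLaplacian p).1 hp
  have hmem : testToL2 Ω φ ∈ (strongLaplacian Ω).domain := by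
    refine ⟨testToL2_mem_H10 φ, testToL2_mem_H1 φ, fun i => ?_⟩
    rw [weakPartial_testToL2]
    exact testToL2_mem_H1 _
  refine (LinearPMap.mem_graph_iff _).2 ⟨⟨_, hmem⟩, rfl, ?_⟩
  change -∑ i, weakPartial i (weakPartial i (testToL2 Ω φ)) = negLaplacianTest Ω φ
  simp only [weakPartial_testToL2, negLaplacianTest_eq]

theorem strongLaplacian_le_weakLaplacian : strongLaplacian Ω ≤ weakLaplacian Ω := by
  refine LinearPMap.le_of_le_graph fun p hp => ?_
  obtain ⟨⟨u, hu, hu'⟩, rfl, hp2⟩ := (LinearPMap.mem_graph_iff' _).1 hp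
  refine (mem_graph_weakLaplacian _).2 ⟨hu, fun v hv => ?_⟩
  refine dirichletForm_eq_inner_of_forall_test (fun φ => ?_) hv
  change dirichletForm u _ = ⟪-∑ i, weakPartial i (weakPartial i u), _⟫_ℝ
  rw [dirichletForm_eq, inner_neg_left, sum_inner, ← Finset.sum_neg_distrib]
  refine Finset.sum_congr rfl fun i _ => ?_
  rw [weakPartial_testToL2]
  exact hasWeakPartial_iff.1 (hasWeakPartial_weakPartial (hu'.2 i i)) φ

theorem weakLaplacian_mem_H10 (u : (weakLaplacian Ω).domain) : (u : L2 Ω) ∈ H10 Ω :=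
  ((mem_graph_weakLaplacian _).1 ((weakLaplacian Ω).mem_graph u)).1

theorem inner_weakLaplacian (u : (weakLaplacian Ω).domain) {v : L2 Ω} (hv : v ∈ H10 Ω) :
    ⟪weakLaplacian Ω u, v⟫_ℝ = dirichletForm (u : L2 Ω) v :=
  (((mem_graph_weakLaplacian _).1 ((weakLaplacian Ω).mem_graph u)).2 v hv).symm

theorem isFormalAdjoint_weakLaplacian : (weakLaplacian Ω).IsFormalAdjoint (weakLaplacian Ω) := by
  intro u v
  rw [inner_weakLaplacian u (weakLaplacian_mem_H10 v), dirichletForm_comm,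
    ← inner_weakLaplacian v (weakLaplacian_mem_H10 u), real_inner_comm]

theorem bijective_weakLaplacian (hN : 1 ≤ N)
    (hΩ : Bornology.IsBounded (Ω : Set (EuclideanSpace ℝ (Fin N)))) :
    Function.Bijective fun u : (weakLaplacian Ω).domain => weakLaplacian Ω u := by
  constructor
  · obtain ⟨c, hc, h⟩ := exists_norm_sq_le_dirichletForm hN hΩ
    refine (injective_iff_map_eq_zero (weakLaplacian Ω).toFun).2 fun u hu => ?_
    have hu' : weakLaplacian Ω u = 0 := hu
    have h1 := h u (weakLaplacian_mem_H10 u)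
    rw [← inner_weakLaplacian u (weakLaplacian_mem_H10 u), hu', inner_zero_left] at h1
    have h2 : ‖(u : L2 Ω)‖ ^ 2 ≤ 0 := nonpos_of_mul_nonpos_right h1 hc
    exact Subtype.ext (norm_eq_zero.1 (pow_eq_zero_iff two_ne_zero |>.1
      (le_antisymm h2 (sq_nonneg _))))
  · intro g
    obtain ⟨u, hu, hug⟩ := exists_dirichletForm_eq_inner hN hΩ g
    obtain ⟨y, -, hy⟩ := (LinearPMap.mem_graph_iff _).1
      ((mem_graph_weakLaplacian (u, g)).2 ⟨hu, hug⟩)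
    exact ⟨y, hy⟩

/-! ### The Friedrichs extension of the classical Laplacian -/

theorem classicalLaplacian_mem_H10 (a : (classicalLaplacian Ω).domain) : (a : L2 Ω) ∈ H10 Ω := by
  obtain ⟨φ, h⟩ := mem_domain_classicalLaplacian.1 a.2
  exact h ▸ testToL2_mem_H10 φ

theorem form_classicalLaplacian (a b : (classicalLaplacian Ω).domain) :
    form (classicalLaplacian Ω) a b = dirichletForm (a : L2 Ω) b := by
  have hle := (classicalLaplacian_le_strongLaplacian (Ω := Ω)).trans
    strongLaplacian_le_weakLaplacian
  rw [form, hle.2 (y := ⟨a, hle.1 a.2⟩) rfl]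
  exact inner_weakLaplacian _ (classicalLaplacian_mem_H10 b)

theorem isFormalAdjoint_classicalLaplacian :
    (classicalLaplacian Ω).IsFormalAdjoint (classicalLaplacian Ω) := by
  intro a b
  have h := form_classicalLaplacian b a
  rw [dirichletForm_comm, ← form_classicalLaplacian a b, form, form, real_inner_comm] at h
  exact h.symm

/-- The energy norm controls the `L²` norm of each partial derivative, so that an approximating
sequence of `u` converges to `u` in `H¹`. -/
theorem tendsto_weakPartial_of_isApprox {w : ℕ → (classicalLaplacian Ω).domain} {u : L2 Ω}
    (h : IsApprox (classicalLaplacian Ω) w u) : u ∈ H10 Ω ∧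
      ∀ i, Tendsto (fun n => weakPartial i (w n : L2 Ω)) atTop (𝓝 (weakPartial i u)) := by
  have hcau (i) : CauchySeq fun n => weakPartial i (w n : L2 Ω) := by
    rw [Metric.cauchySeq_iff]
    intro ε hε
    obtain ⟨n₀, hn₀⟩ := h.1 ε hε
    refine ⟨n₀, fun m hm n hn => lt_of_le_of_lt ?_ (hn₀ m hm n hn)⟩
    have hadd := weakPartial_add i (classicalLaplacian_mem_H10 (w m - w n)).1
      (classicalLaplacian_mem_H10 (w n)).1
    rw [← Submodule.coe_add, sub_add_cancel] at hadd
    rw [dist_eq_norm, hadd, add_sub_cancel_right, energyNorm, form_classicalLaplacian]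
    exact norm_weakPartial_le i _
  choose g hg using fun i => cauchySeq_tendsto_of_complete (hcau i)
  choose φ hφ using fun n => mem_domain_classicalLaplacian.1 (w n).2
  have hlim := h.2
  simp only [← hφ] at hlim hg ⊢
  obtain ⟨h1, h2⟩ := mem_H10_of_tendsto hlim hg
  exact ⟨h1, fun i => h2 i ▸ hg i⟩

theorem exists_isApprox {u : L2 Ω} (hu : u ∈ H10 Ω) :
    ∃ w, IsApprox (classicalLaplacian Ω) w u := by
  obtain ⟨-, φ, hφ, hφ'⟩ := hu
  refine ⟨fun n => ⟨testToL2 Ω (φ n), mem_domain_classicalLaplacian.2 ⟨_, rfl⟩⟩, ?_, hφ⟩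
  have hgrad : Tendsto (fun n => gradTest Ω (φ n)) atTop
      (𝓝 (WithLp.toLp 2 fun i => weakPartial i u)) := by
    have h1 : Tendsto (fun n i => gradTest Ω (φ n) i) atTop (𝓝 fun i => weakPartial i u) :=
      tendsto_pi_nhds.2 fun i => by simpa only [gradTest_apply] using hφ' i
    exact ((PiLp.continuous_toLp 2 _).tendsto _).comp h1
  intro ε hε
  obtain ⟨n₀, hn₀⟩ := Metric.cauchySeq_iff.1 hgrad.cauchySeq ε hε
  refine ⟨n₀, fun m hm n hn => ?_⟩
  have h2 := hn₀ m hm n hn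
  rw [energyNorm, form_classicalLaplacian]
  change √(dirichletForm (testToL2 Ω (φ m) - testToL2 Ω (φ n))
    (testToL2 Ω (φ m) - testToL2 Ω (φ n))) < ε
  rwa [← map_sub, ← norm_gradTest_sq, Real.sqrt_sq (norm_nonneg _), map_sub, ← dist_eq_norm]

theorem formDomain_classicalLaplacian :
    formDomain (classicalLaplacian Ω) = (H10 Ω : Set (L2 Ω)) :=
  Set.Subset.antisymm (fun _ ⟨_, hw⟩ => (tendsto_weakPartial_of_isApprox hw).1)
    fun _ hu => exists_isApprox hu

theorem tendsto_form_of_isApprox {u v : L2 Ω} {a b : ℕ → (classicalLaplacian Ω).domain}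
    (ha : IsApprox (classicalLaplacian Ω) a u) (hb : IsApprox (classicalLaplacian Ω) b v) :
    Tendsto (fun n => form (classicalLaplacian Ω) (a n) (b n)) atTop
      (𝓝 (dirichletForm u v)) := by
  simp only [form_classicalLaplacian]
  exact tendsto_dirichletForm (tendsto_weakPartial_of_isApprox ha).2
    (tendsto_weakPartial_of_isApprox hb).2

theorem formInner_classicalLaplacian {u v : L2 Ω} (hu : u ∈ H10 Ω) (hv : v ∈ H10 Ω) :
    formInner (classicalLaplacian Ω) u v = dirichletForm u v := by
  have h : u ∈ formDomain (classicalLaplacian Ω) ∧ v ∈ formDomain (classicalLaplacian Ω) :=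
    ⟨exists_isApprox hu, exists_isApprox hv⟩
  rw [formInner, dif_pos h]
  exact (tendsto_form_of_isApprox h.1.choose_spec h.2.choose_spec).limUnder_eq

/-- Continuity of `⟪u, ·⟫_V` for the topology of `L²` means representability by an element of
`L²`. -/
theorem mem_extensionDomain_classicalLaplacian {u : L2 Ω} :
    u ∈ extensionDomain (classicalLaplacian Ω) ↔
      u ∈ H10 Ω ∧ ∃ g : L2 Ω, ∀ v ∈ H10 Ω, dirichletForm u v = ⟪g, v⟫_ℝ := by
  have hV := formDomain_classicalLaplacian (Ω := Ω)
  have hmem (v : L2 Ω) : v ∈ formDomain (classicalLaplacian Ω) ↔ v ∈ H10 Ω := by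
    rw [hV, SetLike.mem_coe]
  constructor
  · rintro ⟨hu, hc⟩
    rw [hmem] at hu
    refine ⟨hu, ?_⟩
    let f : H10 Ω →ₗ[ℝ] ℝ :=
      { toFun := fun v => dirichletForm u v
        map_add' := fun v w => by
          rw [Submodule.coe_add, dirichletForm_comm, dirichletForm_add_left v.2.1 w.2.1,
            dirichletForm_comm, dirichletForm_comm u w]
        map_smul' := fun c v => by
          rw [Submodule.coe_smul, dirichletForm_comm, dirichletForm_smul_left c v.2.1,
            dirichletForm_comm, RingHom.id_apply, smul_eq_mul] }
    have hf : Continuous f := by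
      refine (hc.comp (continuous_subtype_val.subtype_mk fun v : H10 Ω => (hmem v).2 v.2)).congr
        fun v => ?_
      exact formInner_classicalLaplacian hu v.2
    obtain ⟨g, hg⟩ := (H10 Ω).exists_inner_eq_of_continuous f hf
    exact ⟨g, fun v hv => hg ⟨v, hv⟩⟩
  · rintro ⟨hu, g, hg⟩
    refine ⟨(hmem u).2 hu, ?_⟩
    refine (continuous_const.inner continuous_subtype_val :
      Continuous fun v : formDomain (classicalLaplacian Ω) => ⟪g, (v : L2 Ω)⟫_ℝ).congr fun v => ?_
    have hv := (hmem v).1 v.2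
    rw [formInner_classicalLaplacian hu hv, hg v hv]

theorem extensionDomain_classicalLaplacian :
    extensionDomain (classicalLaplacian Ω) = ((weakLaplacian Ω).domain : Set (L2 Ω)) := by
  ext u
  rw [mem_extensionDomain_classicalLaplacian, SetLike.mem_coe, LinearPMap.mem_domain_iff]
  simp only [mem_graph_weakLaplacian, exists_and_left]

theorem extensionGraph_classicalLaplacian :
    extensionGraph (classicalLaplacian Ω)
      = ((weakLaplacian Ω).graph : Set (L2 Ω × L2 Ω)) := by
  ext p
  rw [SetLike.mem_coe, mem_graph_weakLaplacian, extensionGraph, Set.mem_ofPred_eq,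
    mem_extensionDomain_classicalLaplacian, formDomain_classicalLaplacian]
  constructor
  · rintro ⟨⟨hu, -⟩, h⟩
    exact ⟨hu, fun v hv => formInner_classicalLaplacian hu hv ▸ h v hv⟩
  · rintro ⟨hu, h⟩
    exact ⟨⟨hu, p.2, h⟩, fun v hv => (formInner_classicalLaplacian hu hv).trans (h v hv)⟩

end Dirichlet

theorem mainTheorem8 (N : ℕ) (hN : 1 ≤ N) (Ω : Opens (EuclideanSpace ℝ (Fin N)))
    (hΩ : Bornology.IsBounded (Ω : Set (EuclideanSpace ℝ (Fin N)))) :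
    -- `T₀` is densely defined, symmetric and, up to a constant factor, positive definite
    (Dense ((classicalLaplacian Ω).domain : Set (L2 Ω)) ∧
      (classicalLaplacian Ω).IsFormalAdjoint (classicalLaplacian Ω) ∧
      ∃ c > 0, ∀ u : (classicalLaplacian Ω).domain,
        c * ‖(u : L2 Ω)‖ ^ 2 ≤ form (classicalLaplacian Ω) u u) ∧
    -- its form domain is `H¹₀`, and the scalar product of the form domain is well defined and
    -- equal to the Dirichlet form
    formDomain (classicalLaplacian Ω) = (H10 Ω : Set (L2 Ω)) ∧
    (∀ u ∈ H10 Ω, ∀ v ∈ H10 Ω,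
      formInner (classicalLaplacian Ω) u v = dirichletForm u v ∧
      ∀ a b : ℕ → (classicalLaplacian Ω).domain,
        IsApprox (classicalLaplacian Ω) a u → IsApprox (classicalLaplacian Ω) b v →
        Tendsto (fun n => form (classicalLaplacian Ω) (a n) (b n)) atTop
          (𝓝 (dirichletForm u v))) ∧
    -- the Friedrichs extension of `T₀` is the weak Dirichlet-Laplacian
    extensionDomain (classicalLaplacian Ω) = ((weakLaplacian Ω).domain : Set (L2 Ω)) ∧
    extensionGraph (classicalLaplacian Ω) = ((weakLaplacian Ω).graph : Set (L2 Ω × L2 Ω)) ∧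
    -- which is densely defined, self-adjoint and bijective
    Dense ((weakLaplacian Ω).domain : Set (L2 Ω)) ∧
    (weakLaplacian Ω)† = weakLaplacian Ω ∧
    Function.Bijective (fun u : (weakLaplacian Ω).domain => weakLaplacian Ω u) ∧
    -- `T₀ ⊂ -Δ ⊂ (-Δ)_ω`
    classicalLaplacian Ω ≤ strongLaplacian Ω ∧
    strongLaplacian Ω ≤ weakLaplacian Ω := by
  have hle := (classicalLaplacian_le_strongLaplacian (Ω := Ω)).trans
    strongLaplacian_le_weakLaplacian
  have hdense : Dense ((weakLaplacian Ω).domain : Set (L2 Ω)) :=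
    dense_domain_classicalLaplacian.mono hle.1
  have hbij := bijective_weakLaplacian hN hΩ
  refine ⟨⟨dense_domain_classicalLaplacian, isFormalAdjoint_classicalLaplacian, ?_⟩,
    formDomain_classicalLaplacian,
    fun u hu v hv => ⟨formInner_classicalLaplacian hu hv, fun a b => tendsto_form_of_isApprox⟩,
    extensionDomain_classicalLaplacian, extensionGraph_classicalLaplacian, hdense,
    LinearPMap.adjoint_eq_self_of_surjective hdense isFormalAdjoint_weakLaplacian hbij.2, hbij,
    classicalLaplacian_le_strongLaplacian, strongLaplacian_le_weakLaplacian⟩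
  obtain ⟨c, hc, h⟩ := exists_norm_sq_le_dirichletForm hN hΩ
  refine ⟨c, hc, fun u => ?_⟩
  rw [form_classicalLaplacian]
  exact h u (classicalLaplacian_mem_H10 u)
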